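/- **The best separable approximation of a Bell-decomposable state minimizes the relative entropy.** Let $|\psi_1\rangle,|\psi_2\rangle=\frac1{\sqrt2}(|{\uparrow\uparrow}\rangle\pm|{\downarrow\downarrow}\rangle)$ and $|\psi_3\rangle,|\psi_4\rangle=\frac1{\sqrt2}(|{\uparrow\downarrow}\rangle\pm|{\downarrow\uparrow}\rangle)$ be the Bell states of two qubits, and let $\rho=\sum_{i=1}^4 p_i|\psi_i\rangle\langle\psi_i|$ with $p_i\ge 0$, $\sum_i p_i=1$, and $p_i<1$ for all $i$ (that is, $\rho$ is not itself a pure Bell state). A state is separable if it is a finite convex combination of pure product states. A Lewenstein–Sanpera decomposition of $\rho$ is $\rho=\lambda\rho_{sep}+(1-\lambda)|\psi\rangle\langle\psi|$ with $\lambda\in[0,1]$, $\rho_{sep}$ separable and $|\psi\rangle$ a pure entangled state; it is optimal if $\lambda$ is maximal among all such decompositions, and then $\rho_{sep}$ is called a best separable approximation of $\rho$. For density matrices let $S(\rho\|\sigma)=\operatorname{tr}\rho(\ln\rho-\ln\sigma)$ if $\operatorname{supp}\rho\subseteq\operatorname{supp}\sigma$, and $S(\rho\|\sigma)=+\infty$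 otherwise. Then $\rho$ has exactly one best separable approximation $\rho_s$; the function $\sigma\mapsto S(\rho\|\sigma)$ on the set of separable states has exactly one minimizer; and this minimizer is $\rho_s$. Explicitly, if $p_k\ge\frac12$ for some $k$, then $\rho_s=\sum_i p_i'|\psi_i\rangle\langle\psi_i|$ with $$p_k'=\tfrac12,\qquad p_i'=\frac{p_i}{2(1-p_k)}\quad(i\ne k),$$ and if $p_k\le\frac12$ for all $k$, then $\rho_s=\rho$. -/

import Mathlib

open scoped Matrix Kronecker

namespace TwoQubit

/-- State vectors of two qubits; the basis index `0` is spin up and `1` is spin down. -/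
abbrev Ket : Type := Fin 2 × Fin 2 → ℂ

/-- Operators on the two-qubit space `ℂ² ⊗ ℂ²`. -/
abbrev Op : Type := Matrix (Fin 2 × Fin 2) (Fin 2 × Fin 2) ℂ

/-- `v` is a unit vector: `⟨v|v⟩ = 1`. -/
def IsUnitVec {ι : Type} [Fintype ι] (v : ι → ℂ) : Prop := star v ⬝ᵥ v = 1

/-- The operator `|v⟩⟨v|`. -/
def proj {ι : Type} (v : ι → ℂ) : Matrix ι ι ℂ := Matrix.vecMulVec v (star v)

/-- The four Bell states `φ⁺, φ⁻, ψ⁺, ψ⁻`, in this order. -/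
noncomputable def bell : Fin 4 → Ket :=
  ![((Real.sqrt 2 : ℂ)⁻¹) • (Pi.single (0, 0) 1 + Pi.single (1, 1) 1),
    ((Real.sqrt 2 : ℂ)⁻¹) • (Pi.single (0, 0) 1 - Pi.single (1, 1) 1),
    ((Real.sqrt 2 : ℂ)⁻¹) • (Pi.single (0, 1) 1 + Pi.single (1, 0) 1),
    ((Real.sqrt 2 : ℂ)⁻¹) • (Pi.single (0, 1) 1 - Pi.single (1, 0) 1)]

/-- The operator `∑ᵢ pᵢ |ψᵢ⟩⟨ψᵢ|`, with `ψᵢ` the Bell states. -/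
noncomputable def bellDiagonal (p : Fin 4 → ℝ) : Op := ∑ i, p i • proj (bell i)

/-- A separable state: a finite convex combination of pure product states. -/
def IsSeparable (σ : Op) : Prop :=
  ∃ (n : ℕ) (w : Fin n → ℝ) (a b : Fin n → Fin 2 → ℂ),
    (∀ i, 0 ≤ w i) ∧ ∑ i, w i = 1 ∧ (∀ i, IsUnitVec (a i)) ∧ (∀ i, IsUnitVec (b i)) ∧
    σ = ∑ i, w i • (proj (a i) ⊗ₖ proj (b i))

/-- A pure entangled state: a unit vector that is not a product vector. -/
def IsPureEntangled (ψ : Ket) : Prop :=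
  IsUnitVec ψ ∧ ¬ ∃ a b : Fin 2 → ℂ, ψ = fun x => a x.1 * b x.2

/-- A Lewenstein-Sanpera decomposition `ρ = l σ + (1 - l) |ψ⟩⟨ψ|`, with `l ∈ [0, 1]`,
`σ` separable and `ψ` a pure entangled state. -/
def IsLSDecomposition (ρ : Op) (l : ℝ) (σ : Op) (ψ : Ket) : Prop :=
  0 ≤ l ∧ l ≤ 1 ∧ IsSeparable σ ∧ IsPureEntangled ψ ∧ ρ = l • σ + (1 - l) • proj ψ

/-- A Lewenstein-Sanpera decomposition whose weight `l` is the largest possible. -/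
def IsOptimalLSDecomposition (ρ : Op) (l : ℝ) (σ : Op) (ψ : Ket) : Prop :=
  IsLSDecomposition ρ l σ ψ ∧
    ∀ (l' : ℝ) (σ' : Op) (ψ' : Ket), IsLSDecomposition ρ l' σ' ψ' → l' ≤ l

/-- `σ` is a best separable approximation of `ρ`: the separable part of an optimal
Lewenstein-Sanpera decomposition of `ρ`. -/
def IsBSA (ρ σ : Op) : Prop := ∃ (l : ℝ) (ψ : Ket), IsOptimalLSDecomposition ρ l σ ψ

open Classical in
/-- Von Neumann relative entropy `S(ρ‖σ) = tr ρ (ln ρ - ln σ)` of two density matrices, equal to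
`+∞` unless `ker σ ⊆ ker ρ` (that is, `supp ρ ⊆ supp σ`). As `Real.log 0 = 0`, the functional
calculus takes the logarithm on the support, which gives `0 ln 0 = 0` and, when `ker σ ⊆ ker ρ`,
the usual value of `tr ρ ln σ`. -/
noncomputable def relEntropy (ρ σ : Op) : EReal :=
  if ∀ v : Ket, σ *ᵥ v = 0 → ρ *ᵥ v = 0 then
    (((ρ * (cfc Real.log ρ - cfc Real.log σ)).trace.re : ℝ) : EReal)
  else ⊤

/-- `σ` is a separable state that minimizes `S(ρ‖·)` over all separable states. -/
def IsRelEntropyMinimizer (ρ σ : Op) : Prop :=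
  IsSeparable σ ∧ ∀ τ : Op, IsSeparable τ → relEntropy ρ σ ≤ relEntropy ρ τ

end TwoQubit

namespace TwoQubit

open scoped ComplexOrder

/-! Everything rests on one linear witness: a separable state has overlap at most 1/2 with every
Bell state (`IsSeparable.expect_bell_le`). For Bell-diagonal states this is also sufficient
(`isSeparable_bellDiagonal`).

If `p k > 1/2`, the expectation of a decomposition in `bell k` gives `p k ≤ l/2 + (1 - l)`, so `l ≤
2(1 - p k)`. Equality forces the pure part to be `bell k`, which determines the separable part.

For the entropy, concavity of the logarithm gives `⟨ψᵢ|ln τ|ψᵢ⟩ ≤ ln qᵢ + tᵢ/qᵢ - 1` with `tᵢ =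
⟨ψᵢ|τ|ψᵢ⟩` (`expect_log_le`). Averaging over `p` bounds `tr ρ ln τ` by `∑ pᵢ ln qᵢ` as soon as `∑ pᵢ
tᵢ/qᵢ ≤ 1`, and for the claimed spectrum this again follows from `t k ≤ 1/2`. Equality makes the
Bell states eigenvectors of `τ`, whence uniqueness (`cross_entropy_le`). -/

lemma inv_sqrt_two_mul_self : ((Real.sqrt 2 : ℂ))⁻¹ * (Real.sqrt 2 : ℂ)⁻¹ = 1 / 2 := by
  rw [← mul_inv, ← Complex.ofReal_mul, Real.mul_self_sqrt (by norm_num)]; norm_num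

/-! ### Rank-one operators. -/

section Projections

variable {ι : Type} [Fintype ι]

lemma proj_mulVec (u v : ι → ℂ) : proj u *ᵥ v = (star u ⬝ᵥ v) • u := by
  rw [proj, Matrix.vecMulVec_mulVec, op_smul_eq_smul]

lemma trace_proj (v : ι → ℂ) : (proj v).trace = star v ⬝ᵥ v := by
  rw [proj, Matrix.trace_vecMulVec, dotProduct_comm]

lemma trace_proj_mul (v : ι → ℂ) (M : Matrix ι ι ℂ) :
    (proj v * M).trace = star v ⬝ᵥ M *ᵥ v := by
  rw [Matrix.trace_mul_comm, proj, Matrix.mul_vecMulVec, Matrix.trace_vecMulVec, dotProduct_comm]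

omit [Fintype ι] in
lemma proj_apply (v : ι → ℂ) (i j : ι) : proj v i j = v i * star (v j) := rfl

lemma posSemidef_proj (v : ι → ℂ) : (proj v).PosSemidef :=
  Matrix.posSemidef_vecMulVec_self_star v

omit [Fintype ι] in
lemma proj_inv_sqrt_two_smul (v : ι → ℂ) :
    proj (((Real.sqrt 2 : ℂ)⁻¹) • v) = (1 / 2 : ℂ) • proj v := by
  ext i j
  have h := inv_sqrt_two_mul_self
  simp only [proj_apply, Pi.smul_apply, smul_eq_mul, star_mul', Matrix.smul_apply, star_inv₀,
    RCLike.star_def, Complex.conj_ofReal]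
  linear_combination (v i * (starRingEnd ℂ) (v j)) * h

lemma expect_proj (u v : ι → ℂ) :
    (star u ⬝ᵥ proj v *ᵥ u).re = ‖star u ⬝ᵥ v‖ ^ 2 := by
  have h : star v ⬝ᵥ u = star (star u ⬝ᵥ v) := by
    rw [Matrix.star_dotProduct]
  rw [proj_mulVec, dotProduct_smul, smul_eq_mul, h, RCLike.star_def, mul_comm, Complex.mul_conj,
    Complex.ofReal_re, Complex.normSq_eq_norm_sq]

end Projections

lemma proj_kronecker_proj (a b : Fin 2 → ℂ) :
    proj a ⊗ₖ proj b = proj (fun x : Fin 2 × Fin 2 => a x.1 * b x.2) := by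
  ext i j
  simp [proj, Matrix.vecMulVec_apply, Matrix.kroneckerMap_apply]
  ring

/-! ### The Bell basis and Bell-diagonal operators. -/

section Bell

lemma bell_orthonormal (i j : Fin 4) :
    star (bell i) ⬝ᵥ bell j = if i = j then 1 else 0 := by
  have h := inv_sqrt_two_mul_self
  fin_cases i <;> fin_cases j <;>
    simp [bell, dotProduct, Fintype.sum_prod_type, Fin.sum_univ_two, Pi.single_apply, h] <;>
    first | linear_combination 2 * h | ring

lemma isUnitVec_bell (i : Fin 4) : IsUnitVec (bell i) := by
  simp [IsUnitVec, bell_orthonormal]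

lemma proj_bell_zero : proj (bell 0) =
    (1 / 2 : ℂ) • proj (Pi.single (0, 0) 1 + Pi.single (1, 1) 1) := proj_inv_sqrt_two_smul _

lemma proj_bell_one : proj (bell 1) =
    (1 / 2 : ℂ) • proj (Pi.single (0, 0) 1 - Pi.single (1, 1) 1) := proj_inv_sqrt_two_smul _

lemma proj_bell_two : proj (bell 2) =
    (1 / 2 : ℂ) • proj (Pi.single (0, 1) 1 + Pi.single (1, 0) 1) := proj_inv_sqrt_two_smul _

lemma proj_bell_three : proj (bell 3) =
    (1 / 2 : ℂ) • proj (Pi.single (0, 1) 1 - Pi.single (1, 0) 1) := proj_inv_sqrt_two_smul _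

lemma sum_proj_bell : ∑ i, proj (bell i) = 1 := by
  rw [Fin.sum_univ_four, proj_bell_zero, proj_bell_one, proj_bell_two, proj_bell_three]
  ext ⟨a, b⟩ ⟨c, d⟩
  fin_cases a <;> fin_cases b <;> fin_cases c <;> fin_cases d <;>
    simp [proj_apply] <;> norm_num

lemma isPureEntangled_bell (i : Fin 4) : IsPureEntangled (bell i) := by
  refine ⟨isUnitVec_bell i, ?_⟩
  rintro ⟨a, b, h⟩
  -- The coefficient matrix of a product vector has rank at most one.
  have hdet : bell i (0, 0) * bell i (1, 1) - bell i (0, 1) * bell i (1, 0) = 0 := by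
    rw [h]; ring
  fin_cases i <;> simp [bell] at hdet

lemma bellDiagonal_mulVec (p : Fin 4 → ℝ) (v : Ket) :
    bellDiagonal p *ᵥ v = ∑ i, ((p i : ℂ) * (star (bell i) ⬝ᵥ v)) • bell i := by
  simp only [bellDiagonal, Matrix.sum_mulVec, Matrix.smul_mulVec, proj_mulVec]
  refine Finset.sum_congr rfl fun i _ => ?_
  rw [mul_smul]; ext x; simp

lemma bellDiagonal_mulVec_bell (p : Fin 4 → ℝ) (i : Fin 4) :
    bellDiagonal p *ᵥ bell i = (p i : ℂ) • bell i := by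
  simp [bellDiagonal_mulVec, bell_orthonormal]

lemma bell_dotProduct_bellDiagonal_mulVec (p : Fin 4 → ℝ) (i : Fin 4) (v : Ket) :
    star (bell i) ⬝ᵥ bellDiagonal p *ᵥ v = p i * (star (bell i) ⬝ᵥ v) := by
  simp [bellDiagonal_mulVec, dotProduct_sum, dotProduct_smul, bell_orthonormal]

lemma bellDiagonal_mulVec_eq_zero_iff (p : Fin 4 → ℝ) (v : Ket) :
    bellDiagonal p *ᵥ v = 0 ↔ ∀ i, p i = 0 ∨ star (bell i) ⬝ᵥ v = 0 := by
  constructor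
  · intro h i
    have := bell_dotProduct_bellDiagonal_mulVec p i v
    rw [h, dotProduct_zero] at this
    simpa using this.symm
  · intro h
    rw [bellDiagonal_mulVec]
    refine Finset.sum_eq_zero fun i _ => ?_
    rcases h i with h | h <;> simp [h]

lemma eq_bellDiagonal_of_mulVec_bell {A : Op} {q : Fin 4 → ℝ}
    (h : ∀ i, A *ᵥ bell i = (q i : ℂ) • bell i) : A = bellDiagonal q := by
  calc A = A * ∑ i, proj (bell i) := by rw [sum_proj_bell, mul_one]
    _ = bellDiagonal q := by
      rw [Finset.mul_sum, bellDiagonal]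
      refine Finset.sum_congr rfl fun i _ => ?_
      rw [proj, Matrix.mul_vecMulVec, h, Matrix.smul_vecMulVec]
      ext; simp

lemma trace_eq_sum_bell (A : Op) : A.trace = ∑ i, star (bell i) ⬝ᵥ A *ᵥ bell i := by
  simp_rw [← trace_proj_mul, ← Matrix.trace_sum, ← Finset.sum_mul, sum_proj_bell, one_mul]

lemma trace_bellDiagonal_mul (p : Fin 4 → ℝ) (M : Op) :
    (bellDiagonal p * M).trace.re = ∑ i, p i * (star (bell i) ⬝ᵥ M *ᵥ bell i).re := by
  simp [bellDiagonal, Finset.sum_mul, Matrix.trace_sum, Matrix.trace_smul,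
    trace_proj_mul]

end Bell

/-! ### Separable states and the Bell-diagonal octahedron. -/

section Separable

lemma sum_norm_sq_of_isUnitVec {a : Fin 2 → ℂ} (ha : IsUnitVec a) :
    ‖a 0‖ ^ 2 + ‖a 1‖ ^ 2 = 1 := by
  have h := congrArg Complex.re ha
  simpa [dotProduct, ← Complex.normSq_eq_norm_sq, Complex.normSq_apply] using h

lemma norm_sq_add_le_one {x₀ x₁ y₀ y₁ : ℂ} (hx : ‖x₀‖ ^ 2 + ‖x₁‖ ^ 2 = 1)
    (hy : ‖y₀‖ ^ 2 + ‖y₁‖ ^ 2 = 1) : ‖x₀ * y₀ + x₁ * y₁‖ ^ 2 ≤ 1 := by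
  have h : ‖x₀ * y₀ + x₁ * y₁‖ ≤ ‖x₀‖ * ‖y₀‖ + ‖x₁‖ * ‖y₁‖ := by
    simpa using norm_add_le (x₀ * y₀) (x₁ * y₁)
  have h1 : ‖x₀‖ * ‖y₀‖ + ‖x₁‖ * ‖y₁‖ ≤ 1 := by
    nlinarith [sq_nonneg (‖x₀‖ - ‖y₀‖), sq_nonneg (‖x₁‖ - ‖y₁‖)]
  exact pow_le_one₀ (norm_nonneg _) (h.trans h1)

/-- Up to the factor `1/√2`, the overlap pairs `a` with `b` permuted and sign-changed, which is
still a unit vector; Cauchy-Schwarz finishes. -/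
lemma norm_sq_bell_dotProduct_product_le {a b : Fin 2 → ℂ} (ha : IsUnitVec a) (hb : IsUnitVec b)
    (k : Fin 4) :
    ‖star (bell k) ⬝ᵥ (fun x : Fin 2 × Fin 2 => a x.1 * b x.2)‖ ^ 2 ≤ 1 / 2 := by
  have ha' := sum_norm_sq_of_isUnitVec ha
  have hb' := sum_norm_sq_of_isUnitVec hb
  have key : ∃ y₀ y₁ : ℂ, ‖y₀‖ ^ 2 + ‖y₁‖ ^ 2 = 1 ∧
      star (bell k) ⬝ᵥ (fun x : Fin 2 × Fin 2 => a x.1 * b x.2)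
        = (Real.sqrt 2 : ℂ)⁻¹ * (a 0 * y₀ + a 1 * y₁) := by
    fin_cases k
    · refine ⟨b 0, b 1, hb', ?_⟩
      simp [bell, dotProduct, Fintype.sum_prod_type, Pi.single_apply]; ring
    · refine ⟨b 0, -b 1, by simpa using hb', ?_⟩
      simp [bell, dotProduct, Fintype.sum_prod_type, Pi.single_apply]; ring
    · refine ⟨b 1, b 0, by linarith, ?_⟩
      simp [bell, dotProduct, Fintype.sum_prod_type, Pi.single_apply]; ring
    · refine ⟨b 1, -b 0, by simpa using by linarith, ?_⟩
      simp [bell, dotProduct, Fintype.sum_prod_type, Pi.single_apply]; ring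
  obtain ⟨y₀, y₁, hy, h⟩ := key
  have := norm_sq_add_le_one ha' hy
  rw [h, norm_mul, mul_pow, norm_inv, Complex.norm_real, Real.norm_of_nonneg (Real.sqrt_nonneg _),
    inv_pow, Real.sq_sqrt (by norm_num)]
  linarith

lemma IsSeparable.posSemidef {σ : Op} (h : IsSeparable σ) : σ.PosSemidef := by
  obtain ⟨n, w, a, b, hw, -, -, -, rfl⟩ := h
  refine Matrix.posSemidef_sum _ fun i _ => ?_
  rw [proj_kronecker_proj]
  exact (posSemidef_proj _).smul (hw i)

lemma IsSeparable.trace_eq_one {σ : Op} (h : IsSeparable σ) : σ.trace = 1 := by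
  obtain ⟨n, w, a, b, -, hw, ha, hb, rfl⟩ := h
  have (i : Fin n) : (proj (a i) ⊗ₖ proj (b i)).trace = 1 := by
    rw [Matrix.trace_kronecker, trace_proj, trace_proj, ha i, hb i, one_mul]
  simp only [Matrix.trace_sum, Matrix.trace_smul, this, Complex.real_smul, mul_one]
  exact_mod_cast hw

lemma IsSeparable.expect_bell_le {σ : Op} (h : IsSeparable σ) (k : Fin 4) :
    (star (bell k) ⬝ᵥ σ *ᵥ bell k).re ≤ 1 / 2 := by
  obtain ⟨n, w, a, b, hw, hw1, ha, hb, rfl⟩ := h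
  have (i : Fin n) : (star (bell k) ⬝ᵥ (proj (a i) ⊗ₖ proj (b i)) *ᵥ bell k).re ≤ 1 / 2 := by
    rw [proj_kronecker_proj, expect_proj]
    exact norm_sq_bell_dotProduct_product_le (ha i) (hb i) k
  calc _ = ∑ i, w i * (star (bell k) ⬝ᵥ (proj (a i) ⊗ₖ proj (b i)) *ᵥ bell k).re := by
        simp [Matrix.sum_mulVec, dotProduct_sum, Matrix.smul_mulVec, dotProduct_smul]
    _ ≤ ∑ i, w i * (1 / 2) := Finset.sum_le_sum fun i _ => mul_le_mul_of_nonneg_left (this i) (hw i)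
    _ = 1 / 2 := by rw [← Finset.sum_mul, hw1, one_mul]

lemma isSeparable_iff_mem_convexHull {σ : Op} :
    IsSeparable σ ↔ σ ∈ convexHull ℝ
      {τ : Op | ∃ a b : Fin 2 → ℂ, IsUnitVec a ∧ IsUnitVec b ∧ τ = proj a ⊗ₖ proj b} := by
  constructor
  · rintro ⟨n, w, a, b, hw, hw1, ha, hb, rfl⟩
    exact (convex_convexHull ℝ _).sum_mem (fun i _ => hw i) hw1
      fun i _ => subset_convexHull ℝ _ ⟨a i, b i, ha i, hb i, rfl⟩
  · intro h
    obtain ⟨ι, _, w, z, hw, hw1, hz, rfl⟩ := mem_convexHull_iff_exists_fintype.1 h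
    choose a b ha hb hab using hz
    let e := (Fintype.equivFin ι).symm
    refine ⟨Fintype.card ι, w ∘ e, a ∘ e, b ∘ e, fun i => hw _, ?_, fun i => ha _, fun i => hb _, ?_⟩
    · rw [← hw1]; exact e.sum_comp w
    · rw [← e.sum_comp]
      exact Finset.sum_congr rfl fun i _ => by simp [hab]

lemma convex_setOf_isSeparable : Convex ℝ {σ : Op | IsSeparable σ} := by
  have h : {σ : Op | IsSeparable σ} = convexHull ℝ _ := Set.ext fun _ =>
    isSeparable_iff_mem_convexHull
  rw [h]
  exact convex_convexHull ℝ _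

lemma isSeparable_product {a b : Fin 2 → ℂ} (ha : IsUnitVec a) (hb : IsUnitVec b) :
    IsSeparable (proj a ⊗ₖ proj b) :=
  isSeparable_iff_mem_convexHull.2 (subset_convexHull ℝ _ ⟨a, b, ha, hb, rfl⟩)

lemma isSeparable_midpoint {a b c d : Fin 2 → ℂ} (ha : IsUnitVec a) (hb : IsUnitVec b)
    (hc : IsUnitVec c) (hd : IsUnitVec d) :
    IsSeparable ((1 / 2 : ℝ) • (proj a ⊗ₖ proj b) + (1 / 2 : ℝ) • (proj c ⊗ₖ proj d)) :=
  convex_setOf_isSeparable (isSeparable_product ha hb) (isSeparable_product hc hd)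
    (by norm_num) (by norm_num) (by norm_num)

/-- The qubit state on the equator of the Bloch sphere with relative phase `z`. -/
noncomputable def equator (z : ℂ) : Fin 2 → ℂ := (Real.sqrt 2 : ℂ)⁻¹ • ![1, z]

lemma proj_equator (z : ℂ) : proj (equator z) = (1 / 2 : ℂ) • proj ![1, z] :=
  proj_inv_sqrt_two_smul _

lemma isUnitVec_equator {z : ℂ} (hz : star z * z = 1) : IsUnitVec (equator z) := by
  have h := inv_sqrt_two_mul_self
  have hz' : (starRingEnd ℂ) z * z = 1 := hz
  simp [IsUnitVec, equator, dotProduct]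
  linear_combination (1 + (starRingEnd ℂ) z * z) * h + 1 / 2 * hz'

lemma isUnitVec_single (i : Fin 2) : IsUnitVec (Pi.single i 1 : Fin 2 → ℂ) := by
  fin_cases i <;> simp [IsUnitVec, dotProduct]

/-- The equal mixture of the Bell states `i` and `j`. -/
noncomputable def bellPair (i j : Fin 4) : Op :=
  (1 / 2 : ℝ) • proj (bell i) + (1 / 2 : ℝ) • proj (bell j)

/-- Each of the six pairs spans an eigenspace of `σ ⊗ σ` for a Pauli matrix `σ`. That eigenspace
also has a basis of products of eigenvectors of `σ`, giving the same mixture. -/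
lemma isSeparable_bellPair_zz :
    IsSeparable (bellPair 0 1) ∧ IsSeparable (bellPair 2 3) := by
  constructor
  · convert isSeparable_midpoint (isUnitVec_single 0) (isUnitVec_single 0)
      (isUnitVec_single 1) (isUnitVec_single 1) using 1
    simp only [bellPair, proj_bell_zero, proj_bell_one]
    ext ⟨a, b⟩ ⟨c, d⟩
    fin_cases a <;> fin_cases b <;> fin_cases c <;> fin_cases d <;>
      simp [proj_apply, Matrix.kroneckerMap_apply] <;> norm_num
  · convert isSeparable_midpoint (isUnitVec_single 0) (isUnitVec_single 1)
      (isUnitVec_single 1) (isUnitVec_single 0) using 1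
    simp only [bellPair, proj_bell_two, proj_bell_three]
    ext ⟨a, b⟩ ⟨c, d⟩
    fin_cases a <;> fin_cases b <;> fin_cases c <;> fin_cases d <;>
      simp [proj_apply, Matrix.kroneckerMap_apply] <;> norm_num

lemma isSeparable_bellPair_xx :
    IsSeparable (bellPair 0 2) ∧ IsSeparable (bellPair 1 3) := by
  have h1 : IsUnitVec (equator 1) := isUnitVec_equator (by simp)
  have h2 : IsUnitVec (equator (-1)) := isUnitVec_equator (by simp)
  constructor
  · convert isSeparable_midpoint h1 h1 h2 h2 using 1
    simp only [bellPair, proj_bell_zero, proj_bell_two, proj_equator]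
    ext ⟨a, b⟩ ⟨c, d⟩
    fin_cases a <;> fin_cases b <;> fin_cases c <;> fin_cases d <;>
      simp [proj_apply, Matrix.kroneckerMap_apply] <;> norm_num
  · convert isSeparable_midpoint h1 h2 h2 h1 using 1
    simp only [bellPair, proj_bell_one, proj_bell_three, proj_equator]
    ext ⟨a, b⟩ ⟨c, d⟩
    fin_cases a <;> fin_cases b <;> fin_cases c <;> fin_cases d <;>
      simp [proj_apply, Matrix.kroneckerMap_apply] <;> norm_num

lemma isSeparable_bellPair_yy :
    IsSeparable (bellPair 1 2) ∧ IsSeparable (bellPair 0 3) := by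
  have h1 : IsUnitVec (equator Complex.I) := isUnitVec_equator (by simp)
  have h2 : IsUnitVec (equator (-Complex.I)) := isUnitVec_equator (by simp)
  have hI := Complex.I_mul_I
  constructor
  · convert isSeparable_midpoint h1 h1 h2 h2 using 1
    simp only [bellPair, proj_bell_one, proj_bell_two, proj_equator]
    ext ⟨a, b⟩ ⟨c, d⟩
    fin_cases a <;> fin_cases b <;> fin_cases c <;> fin_cases d <;>
      simp [proj_apply, Matrix.kroneckerMap_apply] <;>
      first
        | linear_combination (1 / 4 : ℂ) * hI
        | linear_combination (-1 / 4 : ℂ) * hI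
        | norm_num
  · convert isSeparable_midpoint h1 h2 h2 h1 using 1
    simp only [bellPair, proj_bell_zero, proj_bell_three, proj_equator]
    ext ⟨a, b⟩ ⟨c, d⟩
    fin_cases a <;> fin_cases b <;> fin_cases c <;> fin_cases d <;>
      simp [proj_apply, Matrix.kroneckerMap_apply] <;>
      first
        | linear_combination (1 / 4 : ℂ) * hI
        | linear_combination (-1 / 4 : ℂ) * hI
        | norm_num

/-- The admissible spectra form an octahedron whose six vertices are the spectra of the `bellPair`
states. -/
lemma isSeparable_bellDiagonal {q : Fin 4 → ℝ} (hq : ∑ i, q i = 1)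
    (hq0 : ∀ i, 0 ≤ q i) (hq' : ∀ i, q i ≤ 1 / 2) : IsSeparable (bellDiagonal q) := by
  rw [Fin.sum_univ_four] at hq
  have g0 := hq0 0; have g1 := hq0 1; have g2 := hq0 2; have g3 := hq0 3
  have h0 := hq' 0; have h1 := hq' 1; have h2 := hq' 2; have h3 := hq' 3
  -- These are the expectations of `σ ⊗ σ` for the three Pauli matrices; in them the octahedron is
  -- `|x| + |y| + |z| ≤ 1`.
  obtain ⟨x, hx⟩ : ∃ x, x = q 0 - q 1 + q 2 - q 3 := ⟨_, rfl⟩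
  obtain ⟨y, hy⟩ : ∃ y, y = -q 0 + q 1 + q 2 - q 3 := ⟨_, rfl⟩
  obtain ⟨z, hz⟩ : ∃ z, z = q 0 + q 1 - q 2 - q 3 := ⟨_, rfl⟩
  -- The slack is shared equally by the three axes, and within an axis equally by its two opposite
  -- vertices.
  obtain ⟨s, hs⟩ : ∃ s, s = (1 - |x| - |y| - |z|) / 3 := ⟨_, rfl⟩
  have hs0 : 0 ≤ s := by
    rcases abs_cases x with ⟨e1, -⟩ | ⟨e1, -⟩ <;> rcases abs_cases y with ⟨e2, -⟩ | ⟨e2, -⟩ <;>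
      rcases abs_cases z with ⟨e3, -⟩ | ⟨e3, -⟩ <;> rw [hs, e1, e2, e3] <;> linarith
  have hsum := convex_setOf_isSeparable.sum_mem (t := Finset.univ)
    (w := ![(|z| + s + z) / 2, (|z| + s - z) / 2, (|x| + s + x) / 2, (|x| + s - x) / 2,
      (|y| + s + y) / 2, (|y| + s - y) / 2])
    (z := ![bellPair 0 1, bellPair 2 3, bellPair 0 2, bellPair 1 3, bellPair 1 2, bellPair 0 3])
    (by
      have := neg_abs_le x; have := neg_abs_le y; have := neg_abs_le z
      have := le_abs_self x; have := le_abs_self y; have := le_abs_self z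
      intro i _
      fin_cases i <;> simp <;> linarith)
    (by simp [Fin.sum_univ_six]; linarith)
    (by
      intro i _
      fin_cases i
      exacts [isSeparable_bellPair_zz.1, isSeparable_bellPair_zz.2, isSeparable_bellPair_xx.1,
        isSeparable_bellPair_xx.2, isSeparable_bellPair_yy.1, isSeparable_bellPair_yy.2])
  have e0 : q 0 = ((|z| + s + z) + (|x| + s + x) + (|y| + s - y)) / 4 := by linarith
  have e1 : q 1 = ((|z| + s + z) + (|x| + s - x) + (|y| + s + y)) / 4 := by linarith
  have e2 : q 2 = ((|z| + s - z) + (|x| + s + x) + (|y| + s + y)) / 4 := by linarith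
  have e3 : q 3 = ((|z| + s - z) + (|x| + s - x) + (|y| + s - y)) / 4 := by linarith
  refine (congrArg IsSeparable ?_).mpr hsum
  simp [Fin.sum_univ_six, bellDiagonal, Fin.sum_univ_four, bellPair]
  rw [e0, e1, e2, e3]
  module

end Separable

/-! ### Tangent inequality for the matrix logarithm. -/

section Log

lemma log_le_log_add_div_sub_one {x q : ℝ} (hx : 0 < x) (hq : 0 < q) :
    Real.log x ≤ Real.log q + x / q - 1 := by
  have h := Real.log_le_sub_one_of_pos (div_pos hx hq)
  rw [Real.log_div hx.ne' hq.ne'] at h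
  linarith

lemma eq_of_log_eq_log_add_div_sub_one {x q : ℝ} (hx : 0 < x) (hq : 0 < q)
    (h : Real.log x = Real.log q + x / q - 1) : x = q := by
  by_contra hne
  have h' := Real.log_lt_sub_one_of_pos (div_pos hx hq) (by rwa [ne_eq, div_eq_one_iff_eq hq.ne'])
  rw [Real.log_div hx.ne' hq.ne'] at h'
  linarith

variable {n : Type} [Fintype n] [DecidableEq n] {A : Matrix n n ℂ}

/-- For a unit vector the weights form a probability distribution on the spectrum, so scalar
inequalities between functions pass to expectations. -/
lemma expect_cfc (hA : A.IsHermitian) (f : ℝ → ℝ) (v : n → ℂ) :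
    (star v ⬝ᵥ cfc f A *ᵥ v).re =
      ∑ j, f (hA.eigenvalues j) *
        ‖(star (hA.eigenvectorUnitary : Matrix n n ℂ) *ᵥ v) j‖ ^ 2 := by
  rw [hA.cfc_eq, Matrix.IsHermitian.cfc, Unitary.conjStarAlgAut_apply, ← Matrix.mulVec_mulVec,
    ← Matrix.mulVec_mulVec, Matrix.dotProduct_mulVec,
    show star v ᵥ* (hA.eigenvectorUnitary : Matrix n n ℂ)
      = star (star (hA.eigenvectorUnitary : Matrix n n ℂ) *ᵥ v) by
      rw [Matrix.star_mulVec, Matrix.star_eq_conjTranspose, Matrix.conjTranspose_conjTranspose]]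
  simp only [dotProduct, Matrix.mulVec_diagonal, Complex.re_sum]
  refine Finset.sum_congr rfl fun j _ => ?_
  rw [← Complex.normSq_eq_norm_sq, Complex.normSq_apply]
  simp
  ring

lemma sum_norm_sq_star_eigenvectorUnitary (hA : A.IsHermitian) (v : n → ℂ) :
    ∑ j, ‖(star (hA.eigenvectorUnitary : Matrix n n ℂ) *ᵥ v) j‖ ^ 2 = (star v ⬝ᵥ v).re := by
  have h := expect_cfc hA (fun _ => 1) v
  rw [cfc_const_one ℝ A hA.isSelfAdjoint, Matrix.one_mulVec] at h
  simpa using h.symm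

lemma expect_eq_sum (hA : A.IsHermitian) (v : n → ℂ) :
    (star v ⬝ᵥ A *ᵥ v).re = ∑ j, hA.eigenvalues j *
        ‖(star (hA.eigenvectorUnitary : Matrix n n ℂ) *ᵥ v) j‖ ^ 2 := by
  have h := expect_cfc hA (fun x => x) v
  rwa [cfc_id' ℝ A hA.isSelfAdjoint] at h

lemma star_eigenvectorUnitary_mulVec_mulVec (hA : A.IsHermitian) (v : n → ℂ) (j : n) :
    (star (hA.eigenvectorUnitary : Matrix n n ℂ) *ᵥ (A *ᵥ v)) j =
      hA.eigenvalues j * (star (hA.eigenvectorUnitary : Matrix n n ℂ) *ᵥ v) j := by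
  have h := congrArg (fun M => star (hA.eigenvectorUnitary : Matrix n n ℂ) * M)
    hA.spectral_theorem
  simp only [Unitary.conjStarAlgAut_apply, ← mul_assoc, Unitary.coe_star_mul_self, one_mul] at h
  rw [Matrix.mulVec_mulVec, h, ← Matrix.mulVec_mulVec, Matrix.mulVec_diagonal]
  rfl

lemma star_eigenvectorUnitary_mulVec_apply (hA : A.IsHermitian) (v : n → ℂ) (j : n) :
    (star (hA.eigenvectorUnitary : Matrix n n ℂ) *ᵥ v) j =
      star (hA.eigenvectorBasis j).ofLp ⬝ᵥ v := by
  rw [← hA.eigenvectorUnitary_col_eq]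
  rfl

lemma mulVec_eq_smul_iff (hA : A.IsHermitian) (v : n → ℂ) (q : ℝ) :
    A *ᵥ v = (q : ℂ) • v ↔
      ∀ j, (star (hA.eigenvectorUnitary : Matrix n n ℂ) *ᵥ v) j = 0 ∨ hA.eigenvalues j = q := by
  have hinj : Function.Injective
      (fun w : n → ℂ => star (hA.eigenvectorUnitary : Matrix n n ℂ) *ᵥ w) := by
    intro w w' h
    have := congrArg (fun w => (hA.eigenvectorUnitary : Matrix n n ℂ) *ᵥ w) h
    simpa [Matrix.mulVec_mulVec] using this
  rw [← hinj.eq_iff, funext_iff]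
  refine forall_congr' fun j => ?_
  simp only [star_eigenvectorUnitary_mulVec_mulVec, Matrix.mulVec_smul, Pi.smul_apply, smul_eq_mul]
  rw [mul_eq_mul_right_iff, or_comm, Complex.ofReal_inj]

variable {v : n → ℂ} {q : ℝ}

/-- With `Real.log 0 = 0` the tangent inequality can fail at a zero eigenvalue; the kernel condition
gives such eigenvalues no weight in `v`. -/
lemma eigenvalue_pos_or_eq_zero (hA : A.PosSemidef)
    (hker : ∀ u, A *ᵥ u = 0 → star u ⬝ᵥ v = 0) (j : n) :
    (star (hA.isHermitian.eigenvectorUnitary : Matrix n n ℂ) *ᵥ v) j = 0 ∨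
      0 < hA.isHermitian.eigenvalues j := by
  rcases (hA.eigenvalues_nonneg j).eq_or_lt with h | h
  · left
    rw [star_eigenvectorUnitary_mulVec_apply]
    apply hker
    rw [hA.isHermitian.mulVec_eigenvectorBasis, ← h, zero_smul]
  · exact Or.inr h

/-- The tangent inequality for the logarithm of a positive semidefinite matrix. -/
lemma expect_log_le (hA : A.PosSemidef) (hv : IsUnitVec v) (hq : 0 < q)
    (hker : ∀ u, A *ᵥ u = 0 → star u ⬝ᵥ v = 0) :
    (star v ⬝ᵥ cfc Real.log A *ᵥ v).re ≤ Real.log q + (star v ⬝ᵥ A *ᵥ v).re / q - 1 ∧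
    ((star v ⬝ᵥ cfc Real.log A *ᵥ v).re = Real.log q + (star v ⬝ᵥ A *ᵥ v).re / q - 1 ↔
      A *ᵥ v = (q : ℂ) • v) := by
  have hH := hA.isHermitian
  have hone := sum_norm_sq_star_eigenvectorUnitary hH v
  rw [show star v ⬝ᵥ v = 1 from hv, Complex.one_re] at hone
  have hrhs : Real.log q + (star v ⬝ᵥ A *ᵥ v).re / q - 1 =
      ∑ j, (Real.log q + hH.eigenvalues j / q - 1) *
        ‖(star (hH.eigenvectorUnitary : Matrix n n ℂ) *ᵥ v) j‖ ^ 2 := by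
    rw [expect_eq_sum hH, Finset.sum_div]
    simp only [sub_mul, add_mul, Finset.sum_sub_distrib, Finset.sum_add_distrib,
      ← Finset.mul_sum, hone, mul_one, div_mul_eq_mul_div]
  have hle : ∀ j ∈ Finset.univ, Real.log (hH.eigenvalues j) *
        ‖(star (hH.eigenvectorUnitary : Matrix n n ℂ) *ᵥ v) j‖ ^ 2 ≤
      (Real.log q + hH.eigenvalues j / q - 1) *
        ‖(star (hH.eigenvectorUnitary : Matrix n n ℂ) *ᵥ v) j‖ ^ 2 := by
    intro j _
    rcases eigenvalue_pos_or_eq_zero hA hker j with h | h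
    · simp [h]
    · exact mul_le_mul_of_nonneg_right (log_le_log_add_div_sub_one h hq) (sq_nonneg _)
  rw [hrhs, expect_cfc hH]
  refine ⟨Finset.sum_le_sum hle, ?_⟩
  rw [Finset.sum_eq_sum_iff_of_le hle, mulVec_eq_smul_iff hH]
  simp only [Finset.mem_univ, true_imp_iff]
  refine forall_congr' fun j => ?_
  rcases eigenvalue_pos_or_eq_zero hA hker j with h | h
  · simp [h]
  · rw [mul_eq_mul_right_iff, or_comm]
    refine or_congr (by simp) ⟨eq_of_log_eq_log_add_div_sub_one h hq, fun e => ?_⟩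
    rw [e, div_self hq.ne']; ring

end Log

/-! ### Minimizers of the relative entropy. -/

section RelativeEntropy

/-- The hypotheses on the spectrum `q` of a Bell-diagonal state that make it the relative entropy
minimizer: `q` has the support of `p`, and the linear functional `t ↦ ∑ pᵢ tᵢ / qᵢ` is at most
`1` on the Bell spectra of separable states. -/
structure IsOptimalSpectrum (p q : Fin 4 → ℝ) : Prop where
  sum_eq_one : ∑ i, q i = 1
  pos : ∀ i, 0 < p i → 0 < q i
  eq_zero : ∀ i, p i = 0 → q i = 0
  le_half : ∀ i, q i ≤ 1 / 2
  tangent : ∀ t : Fin 4 → ℝ, (∀ i, 0 ≤ t i) → ∑ i, t i = 1 → (∀ i, t i ≤ 1 / 2) →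
    ∑ i, p i * (t i / q i) ≤ 1

variable {p q : Fin 4 → ℝ}

lemma IsOptimalSpectrum.nonneg (h : IsOptimalSpectrum p q) (hp : ∀ i, 0 ≤ p i) (i : Fin 4) :
    0 ≤ q i := by
  rcases (hp i).eq_or_lt with h0 | h0
  · exact (h.eq_zero i h0.symm).ge
  · exact (h.pos i h0).le

lemma IsOptimalSpectrum.isSeparable (h : IsOptimalSpectrum p q) (hp : ∀ i, 0 ≤ p i) :
    IsSeparable (bellDiagonal q) :=
  isSeparable_bellDiagonal h.sum_eq_one (h.nonneg hp) h.le_half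

lemma IsOptimalSpectrum.ker_le (h : IsOptimalSpectrum p q) (hp : ∀ i, 0 ≤ p i) (v : Ket)
    (hv : bellDiagonal q *ᵥ v = 0) : bellDiagonal p *ᵥ v = 0 := by
  rw [bellDiagonal_mulVec_eq_zero_iff] at hv ⊢
  intro i
  rcases (hp i).eq_or_lt with h0 | h0
  · exact Or.inl h0.symm
  · exact Or.inr ((hv i).resolve_left (h.pos i h0).ne')

/-- The cross term `tr ρ ln σ` of the relative entropy from a Bell-diagonal state. -/
lemma cross_entropy_le (h : IsOptimalSpectrum p q) (hp : ∀ i, 0 ≤ p i) (hp1 : ∑ i, p i = 1)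
    {τ : Op} (hτ : IsSeparable τ) (hker : ∀ v : Ket, τ *ᵥ v = 0 → bellDiagonal p *ᵥ v = 0) :
    (bellDiagonal p * cfc Real.log τ).trace.re ≤ ∑ i, p i * Real.log (q i) ∧
    ((bellDiagonal p * cfc Real.log τ).trace.re = ∑ i, p i * Real.log (q i) →
      τ = bellDiagonal q) := by
  have hpsd := hτ.posSemidef
  set t : Fin 4 → ℝ := fun i => (star (bell i) ⬝ᵥ τ *ᵥ bell i).re with ht
  have ht0 (i : Fin 4) : 0 ≤ t i := hpsd.re_dotProduct_nonneg (bell i)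
  have ht1 : ∑ i, t i = 1 := by
    have := congrArg Complex.re (trace_eq_sum_bell τ)
    rw [hτ.trace_eq_one, Complex.re_sum] at this
    simpa using this.symm
  have hlog (i : Fin 4) (hi : 0 < p i) := expect_log_le hpsd (isUnitVec_bell i) (h.pos i hi)
    (fun u hu => by
      have := ((bellDiagonal_mulVec_eq_zero_iff p u).1 (hker u hu) i).resolve_left hi.ne'
      rw [Matrix.star_dotProduct, this, star_zero])
  have hterm : ∀ i ∈ Finset.univ, p i * (star (bell i) ⬝ᵥ cfc Real.log τ *ᵥ bell i).re ≤
      p i * (Real.log (q i) + t i / q i - 1) := by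
    intro i _
    rcases (hp i).eq_or_lt with h0 | h0
    · simp [← h0]
    · exact mul_le_mul_of_nonneg_left (hlog i h0).1 h0.le
  have hsum : ∑ i, p i * (Real.log (q i) + t i / q i - 1) =
      ∑ i, p i * Real.log (q i) + (∑ i, p i * (t i / q i) - 1) := by
    simp only [mul_sub, mul_add, Finset.sum_sub_distrib, Finset.sum_add_distrib, mul_one, hp1]
    ring
  have htan := h.tangent t ht0 ht1 hτ.expect_bell_le
  rw [trace_bellDiagonal_mul]
  have hle := Finset.sum_le_sum hterm
  refine ⟨by linarith, fun heq => eq_bellDiagonal_of_mulVec_bell ?_⟩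
  have heq' := (Finset.sum_eq_sum_iff_of_le hterm).1 (by linarith)
  have hpos (i : Fin 4) (hi : 0 < p i) : τ *ᵥ bell i = (q i : ℂ) • bell i :=
    (hlog i hi).2.1 (mul_left_cancel₀ hi.ne' (heq' i (Finset.mem_univ i)))
  -- The equality case says nothing where `p i = 0`. There `q i = 0`, and since `q` and `t` both sum
  -- to 1, `t i = 0` too; positivity of `τ` then gives `τ *ᵥ bell i = 0`.
  have hqt : ∀ i ∈ Finset.univ, q i ≤ t i := by
    intro i _
    rcases (hp i).eq_or_lt with h0 | h0
    · rw [h.eq_zero i h0.symm]; exact ht0 i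
    · simp [ht, hpos i h0, dotProduct_smul, bell_orthonormal]
  have hqt' := (Finset.sum_eq_sum_iff_of_le hqt).1 (h.sum_eq_one.trans ht1.symm)
  intro i
  rcases (hp i).eq_or_lt with h0 | h0
  · have hti : t i = 0 := by rw [← hqt' i (Finset.mem_univ i), h.eq_zero i h0.symm]
    rw [h.eq_zero i h0.symm, Complex.ofReal_zero, zero_smul, ← hpsd.dotProduct_mulVec_zero_iff]
    refine Complex.ext hti ?_
    exact (Complex.nonneg_iff.1 (hpsd.dotProduct_mulVec_nonneg (bell i))).2.symm
  · exact hpos i h0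

lemma cross_entropy_bellDiagonal (h : IsOptimalSpectrum p q) (hp : ∀ i, 0 ≤ p i) :
    (bellDiagonal p * cfc Real.log (bellDiagonal q)).trace.re = ∑ i, p i * Real.log (q i) := by
  rw [trace_bellDiagonal_mul]
  refine Finset.sum_congr rfl fun i _ => ?_
  rcases (hp i).eq_or_lt with h0 | h0
  · simp [← h0]
  · have hq := h.pos i h0
    have := (expect_log_le (h.isSeparable hp).posSemidef (isUnitVec_bell i) hq (fun u hu => by
      have := ((bellDiagonal_mulVec_eq_zero_iff q u).1 hu i).resolve_left hq.ne'
      rw [Matrix.star_dotProduct, this, star_zero])).2.2 (bellDiagonal_mulVec_bell q i)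
    rw [this, bellDiagonal_mulVec_bell, dotProduct_smul, bell_orthonormal]
    simp [hq.ne']

theorem isRelEntropyMinimizer_iff (h : IsOptimalSpectrum p q) (hp : ∀ i, 0 ≤ p i)
    (hp1 : ∑ i, p i = 1) (σ : Op) :
    IsRelEntropyMinimizer (bellDiagonal p) σ ↔ σ = bellDiagonal q := by
  have hq := cross_entropy_bellDiagonal h hp
  have hval (τ : Op) (hker : ∀ v : Ket, τ *ᵥ v = 0 → bellDiagonal p *ᵥ v = 0) :
      relEntropy (bellDiagonal p) τ =
        (((bellDiagonal p * cfc Real.log (bellDiagonal p)).trace.re -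
          (bellDiagonal p * cfc Real.log τ).trace.re : ℝ) : EReal) := by
    rw [relEntropy, if_pos hker, mul_sub, Matrix.trace_sub, Complex.sub_re]
  constructor
  · rintro ⟨hσ, hmin⟩
    have hle := hmin _ (h.isSeparable hp)
    rw [hval _ (h.ker_le hp)] at hle
    by_cases hker : ∀ v : Ket, σ *ᵥ v = 0 → bellDiagonal p *ᵥ v = 0
    · rw [hval σ hker, EReal.coe_le_coe_iff, hq] at hle
      have hc := cross_entropy_le h hp hp1 hσ hker
      exact hc.2 (le_antisymm hc.1 (by linarith))
    · rw [relEntropy, if_neg hker] at hle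
      exact absurd (top_le_iff.1 hle) (EReal.coe_ne_top _)
  · rintro rfl
    refine ⟨h.isSeparable hp, fun τ hτ => ?_⟩
    by_cases hker : ∀ v : Ket, τ *ᵥ v = 0 → bellDiagonal p *ᵥ v = 0
    · rw [hval _ (h.ker_le hp), hval τ hker, EReal.coe_le_coe_iff, hq]
      linarith [(cross_entropy_le h hp hp1 hτ hker).1]
    · rw [relEntropy.eq_1 _ τ, if_neg hker]
      exact le_top

end RelativeEntropy

/-! ### Optimal Lewenstein-Sanpera decompositions. -/

section BestSeparableApproximation

lemma norm_sq_overlap {ι : Type} [Fintype ι] {u v : ι → ℂ} (hu : IsUnitVec u)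
    (hv : IsUnitVec v) :
    ‖star u ⬝ᵥ v‖ ^ 2 ≤ 1 ∧ (‖star u ⬝ᵥ v‖ ^ 2 = 1 → proj v = proj u) := by
  set c := star u ⬝ᵥ v with hc
  have hcv : star v ⬝ᵥ u = star c := by rw [hc, Matrix.star_dotProduct]
  have hcc : c * star c = ((‖c‖ ^ 2 : ℝ) : ℂ) := by
    rw [RCLike.star_def, Complex.mul_conj, Complex.normSq_eq_norm_sq]
  have hu' : star u ⬝ᵥ u = 1 := hu
  have hv' : star v ⬝ᵥ v = 1 := hv
  -- The component of `v` orthogonal to `u`: its norm gives the bound, and its vanishing the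
  -- equality case.
  have hnorm : star (v - c • u) ⬝ᵥ (v - c • u) = ((1 - ‖c‖ ^ 2 : ℝ) : ℂ) := by
    rw [star_sub, star_smul, sub_dotProduct, dotProduct_sub, dotProduct_sub, dotProduct_smul,
      smul_dotProduct, smul_dotProduct, dotProduct_smul, hu', hv', hcv, ← hc]
    simp only [smul_eq_mul, mul_one]
    push_cast at hcc ⊢
    linear_combination -hcc
  refine ⟨?_, fun h1 => ?_⟩
  · have hnn := dotProduct_star_self_nonneg (v - c • u)
    rw [hnorm, Complex.zero_le_real] at hnn
    linarith
  · rw [h1, sub_self, Complex.ofReal_zero, dotProduct_star_self_eq_zero, sub_eq_zero]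
      at hnorm
    rw [h1, Complex.ofReal_one] at hcc
    ext i j
    rw [hnorm, proj_apply, proj_apply]
    simp only [Pi.smul_apply, smul_eq_mul, star_mul']
    linear_combination (u i * star (u j)) * hcc

variable {p : Fin 4 → ℝ}

theorem isBSA_iff_of_le_half (hp : ∀ i, 0 ≤ p i) (hp1 : ∑ i, p i = 1)
    (hhalf : ∀ i, p i ≤ 1 / 2) (σ : Op) :
    IsBSA (bellDiagonal p) σ ↔ σ = bellDiagonal p := by
  -- The pure part has weight 0, so any entangled vector serves.
  have hdec : IsLSDecomposition (bellDiagonal p) 1 (bellDiagonal p) (bell 0) :=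
    ⟨zero_le_one, le_rfl, isSeparable_bellDiagonal hp1 hp hhalf, isPureEntangled_bell 0, by simp⟩
  constructor
  · rintro ⟨l, ψ, ⟨-, hl1, -, -, heq⟩, hopt⟩
    obtain rfl : l = 1 := le_antisymm hl1 (hopt _ _ _ hdec)
    simpa using heq.symm
  · rintro rfl
    exact ⟨1, bell 0, hdec, fun l' _ _ h => h.2.1⟩

/-- The Bell spectrum of the best separable approximation when `1 / 2 ≤ p k`. -/
noncomputable def bsaSpectrum (p : Fin 4 → ℝ) (k : Fin 4) : Fin 4 → ℝ :=
  fun i => if i = k then 1 / 2 else p i / (2 * (1 - p k))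

lemma bellDiagonal_eq_add_bsaSpectrum {k : Fin 4} (hk : p k < 1) :
    bellDiagonal p = (2 * (1 - p k)) • bellDiagonal (bsaSpectrum p k) +
      (1 - 2 * (1 - p k)) • proj (bell k) := by
  have hne : 2 * (1 - p k) ≠ 0 := by linarith
  have hproj : (1 - 2 * (1 - p k)) • proj (bell k) =
      ∑ i, (if i = k then 1 - 2 * (1 - p k) else 0) • proj (bell i) := by simp
  rw [hproj, bellDiagonal, bellDiagonal, Finset.smul_sum, ← Finset.sum_add_distrib]
  refine Finset.sum_congr rfl fun i _ => ?_
  rw [smul_smul, ← add_smul]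
  congr 1
  by_cases h : i = k
  · subst h; simp only [bsaSpectrum, if_true]; ring
  · simp only [bsaSpectrum, if_neg h, add_zero, mul_div_cancel₀ _ hne]

lemma sum_erase_eq (hp1 : ∑ i, p i = 1) (k : Fin 4) :
    ∑ i ∈ Finset.univ.erase k, p i = 1 - p k := by
  rw [← hp1, ← Finset.add_sum_erase _ p (Finset.mem_univ k)]; ring

lemma isOptimalSpectrum_bsaSpectrum (hp : ∀ i, 0 ≤ p i) (hp1 : ∑ i, p i = 1) {k : Fin 4}
    (hk : p k < 1) (hk' : 1 / 2 ≤ p k) : IsOptimalSpectrum p (bsaSpectrum p k) := by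
  have hpos : 0 < 2 * (1 - p k) := by linarith
  have hsum := sum_erase_eq hp1 k
  refine ⟨?_, fun i hi => ?_, fun i hi => ?_, fun i => ?_, fun t ht ht1 ht2 => ?_⟩
  · rw [← Finset.add_sum_erase _ _ (Finset.mem_univ k), Finset.sum_congr rfl
      (g := fun i => p i / (2 * (1 - p k)))
      (fun i hi => by simp [bsaSpectrum, Finset.ne_of_mem_erase hi]), ← Finset.sum_div, hsum]
    simp only [bsaSpectrum, if_true]
    rw [div_mul_cancel_right₀ (by linarith : 1 - p k ≠ 0)]
    norm_num
  · rw [bsaSpectrum]; split_ifs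
    · norm_num
    · positivity
  · have : i ≠ k := by rintro rfl; linarith
    simp [bsaSpectrum, this, hi]
  · rw [bsaSpectrum]; split_ifs with h
    · exact le_rfl
    · rw [div_le_iff₀ hpos]
      have := Finset.single_le_sum (fun j _ => hp j)
        (Finset.mem_erase.2 ⟨h, Finset.mem_univ i⟩)
      linarith
  -- The sum is at most `2 p_k t_k + 2(1 - p_k)(1 - t_k) = 1 - (2 p_k - 1)(1 - 2 t_k)`.
  · have htk := ht2 k
    have hts := sum_erase_eq ht1 k
    have hle : ∑ i ∈ Finset.univ.erase k, p i * (t i / bsaSpectrum p k i) ≤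
        ∑ i ∈ Finset.univ.erase k, 2 * (1 - p k) * t i := by
      refine Finset.sum_le_sum fun i hi => ?_
      simp only [bsaSpectrum, if_neg (Finset.ne_of_mem_erase hi)]
      rcases (hp i).eq_or_lt with h0 | h0
      · rw [← h0, zero_mul]; exact mul_nonneg hpos.le (ht i)
      · exact le_of_eq (by field_simp)
    rw [← Finset.mul_sum, hts] at hle
    rw [← Finset.add_sum_erase _ _ (Finset.mem_univ k)]
    have hkk : p k * (t k / bsaSpectrum p k k) = 2 * p k * t k := by
      simp only [bsaSpectrum, if_true]; ring
    rw [hkk]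
    nlinarith

lemma isOptimalSpectrum_self (hp1 : ∑ i, p i = 1) (hhalf : ∀ i, p i ≤ 1 / 2) :
    IsOptimalSpectrum p p := by
  refine ⟨hp1, fun _ h => h, fun _ h => h, hhalf, fun t ht ht1 _ => ?_⟩
  rw [← ht1]
  refine Finset.sum_le_sum fun i _ => ?_
  by_cases h : p i = 0
  · simpa [h] using ht i
  · exact (mul_div_cancel₀ (t i) h).le

theorem isBSA_iff_of_half_lt (hp : ∀ i, 0 ≤ p i) (hp1 : ∑ i, p i = 1) {k : Fin 4}
    (hk : p k < 1) (hk' : 1 / 2 < p k) (σ : Op) :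
    IsBSA (bellDiagonal p) σ ↔ σ = bellDiagonal (bsaSpectrum p k) := by
  have hρ := bellDiagonal_eq_add_bsaSpectrum hk
  have hdec : IsLSDecomposition (bellDiagonal p) (2 * (1 - p k))
      (bellDiagonal (bsaSpectrum p k)) (bell k) :=
    ⟨by linarith, by linarith,
      (isOptimalSpectrum_bsaSpectrum hp hp1 hk hk'.le).isSeparable hp, isPureEntangled_bell k, hρ⟩
  have hexp {l : ℝ} {τ : Op} {ψ : Ket} (h : IsLSDecomposition (bellDiagonal p) l τ ψ) :
      p k = l * (star (bell k) ⬝ᵥ τ *ᵥ bell k).re + (1 - l) * ‖star (bell k) ⬝ᵥ ψ‖ ^ 2 := by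
    have h1 := congrArg (fun M : Op => (star (bell k) ⬝ᵥ M *ᵥ bell k).re) h.2.2.2.2
    simp only [bell_dotProduct_bellDiagonal_mulVec, bell_orthonormal, if_true, mul_one,
      Complex.ofReal_re, Matrix.add_mulVec, dotProduct_add, Matrix.smul_mulVec, dotProduct_smul,
      Complex.add_re, Complex.smul_re, expect_proj, smul_eq_mul] at h1
    exact h1
  have hbound (l : ℝ) (τ : Op) (ψ : Ket) (h : IsLSDecomposition (bellDiagonal p) l τ ψ) :
      l ≤ 2 * (1 - p k) := by
    have h1 := mul_le_mul_of_nonneg_left (h.2.2.1.expect_bell_le k) h.1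
    have h2 := mul_le_mul_of_nonneg_left
      (norm_sq_overlap (isUnitVec_bell k) h.2.2.2.1.1).1 (sub_nonneg.2 h.2.1)
    linarith [hexp h]
  constructor
  · rintro ⟨l, ψ, h, hopt⟩
    obtain rfl : l = 2 * (1 - p k) := le_antisymm (hbound _ _ _ h) (hopt _ _ _ hdec)
    have hov := norm_sq_overlap (isUnitVec_bell k) h.2.2.2.1.1
    have hψ : proj ψ = proj (bell k) := by
      refine hov.2 (le_antisymm hov.1 ?_)
      have h1 := mul_le_mul_of_nonneg_left (h.2.2.1.expect_bell_le k) h.1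
      have h2 := hexp h
      -- Here `1 - l > 0` because `p k > 1/2` strictly, so the weight can be cancelled.
      nlinarith
    have heq := h.2.2.2.2
    rw [hρ, hψ] at heq
    exact (smul_right_injective Op (by linarith : 2 * (1 - p k) ≠ 0)
      (add_right_cancel heq)).symm
  · rintro rfl
    exact ⟨_, _, hdec, hbound⟩

end BestSeparableApproximation
end TwoQubit

theorem mainTheorem2 (p : Fin 4 → ℝ) (hp_nonneg : ∀ i, 0 ≤ p i) (hp_sum : ∑ i, p i = 1)
    (hp_lt : ∀ i, p i < 1) :
    ∃ ρs : TwoQubit.Op,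
      (∀ σ : TwoQubit.Op, TwoQubit.IsBSA (TwoQubit.bellDiagonal p) σ ↔ σ = ρs) ∧
      (∀ σ : TwoQubit.Op,
        TwoQubit.IsRelEntropyMinimizer (TwoQubit.bellDiagonal p) σ ↔ σ = ρs) ∧
      (∀ k : Fin 4, 1 / 2 ≤ p k →
        ρs = TwoQubit.bellDiagonal
          (fun i => if i = k then 1 / 2 else p i / (2 * (1 - p k)))) ∧
      ((∀ k : Fin 4, p k ≤ 1 / 2) → ρs = TwoQubit.bellDiagonal p) := by
  by_cases hk : ∃ k, 1 / 2 < p k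
  · obtain ⟨k, hk⟩ := hk
    refine ⟨TwoQubit.bellDiagonal (TwoQubit.bsaSpectrum p k),
      TwoQubit.isBSA_iff_of_half_lt hp_nonneg hp_sum (hp_lt k) hk,
      TwoQubit.isRelEntropyMinimizer_iff
        (TwoQubit.isOptimalSpectrum_bsaSpectrum hp_nonneg hp_sum (hp_lt k) hk.le)
        hp_nonneg hp_sum, fun j hj => ?_, fun h => absurd (h k) (not_le.2 hk)⟩
    obtain rfl : j = k := by
      by_contra hne
      have := Finset.single_le_sum (fun i _ => hp_nonneg i)
        (Finset.mem_erase.2 ⟨hne, Finset.mem_univ j⟩)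
      linarith [TwoQubit.sum_erase_eq hp_sum k]
    rfl
  · push Not at hk
    refine ⟨TwoQubit.bellDiagonal p,
      TwoQubit.isBSA_iff_of_le_half hp_nonneg hp_sum hk,
      TwoQubit.isRelEntropyMinimizer_iff (TwoQubit.isOptimalSpectrum_self hp_sum hk)
        hp_nonneg hp_sum, fun k hk' => ?_, fun _ => rfl⟩
    -- On the boundary `2(1 - p k) = 1`, so the two explicit formulas agree.
    have hpk : p k = 1 / 2 := le_antisymm (hk k) hk'
    congr 1
    funext i
    split_ifs with h
    · rw [h, hpk]
    · rw [hpk]; norm_num
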